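/- A finite simple connected graph $G$ is called diameter-$k$-critical if its diameter equals $k$ and, for every edge $e$ of $G$, the graph $G-e$ obtained by deleting $e$ has diameter greater than $k$ (the diameter of a disconnected graph being $\infty$). Write $e(G)$ for the number of edges of $G$. Theorem. There is a function $f:\mathbb{N}\to\mathbb{R}$, not depending on $k$, with $f(n)=o(n^2)$ as $n\to\infty$, such that for every integer $k\ge 3$ and every diameter-$k$-critical graph $G$ on $n$ vertices, $$e(G)\le \frac{n^2}{2k}+k^2 f(n).$$ -/

import Mathlib

/-- `G` is diameter-`k`-critical: its diameter equals `k`, and deleting any single edge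
makes the diameter larger than `k` (infinite diameter, i.e. a disconnected graph, is allowed
after the deletion).  `SimpleGraph.ediam` is the `ℕ∞`-valued supremum of the distances, where
vertices in different components are at distance `⊤`; so on a nonempty vertex set the first
clause also says that `G` is connected. -/
def SimpleGraph.IsDiameterCritical {V : Type*} (G : SimpleGraph V) (k : ℕ) : Prop :=
  G.ediam = (k : ℕ∞) ∧ ∀ e ∈ G.edgeSet, (k : ℕ∞) < (G.deleteEdges {e}).ediam

open Finset

namespace SimpleGraph

/-! ### Edges forced on geodesics, and what criticality forces. -/

section UniqueStep

variable {V : Type*} {G : SimpleGraph V} {u v w x y a b : V} {k : ℕ}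

/-! Deleting an edge `uv` destroys all short paths between some `x` and `y`, say `x … u v … y`.
Along these paths lie vertices at distances `1, …, l` from `u`, and `1, …, m` from `v`, whose
geodesics from that end must begin with the edge `uv`. Here `l + m ≥ k + 1` if `uv` is in a triangle
and `l + m ≥ k` if it is in a 4-cycle (`exists_hasStepLength`). Choosing one end for each `(u, v,
j)` charges distinct ordered pairs of vertices.

Let `A`, `T`, `S` be the degree sums of `G`, of the edges in no triangle, and of the edges in no
triangle or 4-cycle; let `P` count the chosen pairs. Then `(k+1)A ≤ 2P + T + kS`, while `n² + D = 2P
+ U`, where `D` counts pairs chosen in both orders and `U` those chosen in neither. By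
Ruzsa–Szemerédi at each distance `d ≥ 2`, `D ≤ A + k·o(n²)`. Two-edge paths outside triangles end in
mostly unchosen pairs, so `U ≥ T - o(n²)`. Finally `S = O(n^{3/2})`. The terms `A` and `T` cancel,
leaving `kA ≤ n² + k·o(n²)`, with `A = 2e(G)`. -/

theorem Connected.dist_add_one_add_dist_le_length (hG : G.Connected) (p : G.Walk a b)
    (h : s(u, v) ∈ p.edges) :
    G.dist a u + 1 + G.dist v b ≤ p.length ∨ G.dist a v + 1 + G.dist u b ≤ p.length := by
  induction p with
  | nil => simp at h
  | @cons a c b hac p ih =>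
    rw [Walk.edges_cons, List.mem_cons] at h
    rw [Walk.length_cons]
    rcases h with h | h
    · have := G.dist_le p
      rcases Sym2.eq_iff.1 h with ⟨rfl, rfl⟩ | ⟨rfl, rfl⟩
      · left; simp only [dist_self]; omega
      · right; simp only [dist_self]; omega
    · have h1 : G.dist a c = 1 := dist_eq_one_iff_adj.2 hac
      have h2 : G.dist a u ≤ G.dist a c + G.dist c u := hG.dist_triangle
      have h3 : G.dist a v ≤ G.dist a c + G.dist c v := hG.dist_triangle
      rcases ih h with h | h
      · left; omega
      · right; omega

/-- A geodesic not using the edge `uv` survives the deletion of `uv`. -/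
theorem Connected.edist_deleteEdges_le (hG : G.Connected)
    (h₁ : G.dist a b < G.dist a u + 1 + G.dist v b)
    (h₂ : G.dist a b < G.dist a v + 1 + G.dist u b) :
    (G.deleteEdges {s(u, v)}).edist a b ≤ G.dist a b := by
  obtain ⟨p, hp⟩ := hG.exists_walk_length_eq_dist a b
  have hnot : s(u, v) ∉ p.edges := fun h ↦ by
    rcases hG.dist_add_one_add_dist_le_length p h with h | h <;> omega
  have := edist_le (p.toDeleteEdge s(u, v) hnot)
  rwa [Walk.length_transfer, hp] at this

theorem edist_deleteEdges_le_one (hab : G.Adj a b) (hne : s(a, b) ≠ s(u, v)) :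
    (G.deleteEdges {s(u, v)}).edist a b ≤ 1 :=
  (edist_eq_one_iff_adj.2 (by simpa [deleteEdges_adj, hab] using hne)).le

/-- The edge `uv` is the first edge of every geodesic from `u` to `y`. -/
def IsUniqueStep (G : SimpleGraph V) (u v y : V) : Prop :=
  G.Adj u v ∧ G.dist u y = G.dist v y + 1 ∧ ∀ w, G.Adj u w → G.dist w y < G.dist u y → w = v

theorem IsUniqueStep.eq (h : G.IsUniqueStep u v y) (h' : G.IsUniqueStep u w y) : v = w :=
  h'.2.2 v h.1 (by have := h.2.1; omega)

/-- Some vertex at distance `j` from `u` has all its geodesics from `u` start with `uv`. -/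
def HasStepLength (G : SimpleGraph V) (u v : V) (j : ℕ) : Prop :=
  ∃ y, G.IsUniqueStep u v y ∧ G.dist u y = j

theorem Connected.exists_dist_eq (hG : G.Connected) {i : ℕ} (hi : i ≤ G.dist v y) :
    ∃ z, G.dist v z = i ∧ G.dist z y = G.dist v y - i := by
  obtain ⟨p, hp⟩ := hG.exists_walk_length_eq_dist v y
  refine ⟨p.getVert i, ?_⟩
  have h1 := G.dist_le (p.take i)
  have h2 := G.dist_le (p.drop i)
  rw [Walk.take_length] at h1
  rw [Walk.drop_length] at h2
  have h3 : G.dist v y ≤ G.dist v (p.getVert i) + G.dist (p.getVert i) y := hG.dist_triangle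
  omega

/-- If `xy` is a critical pair for `uv`, traversed as `x … u v … y`, then the edge `uv` is forced
for every vertex of a geodesic from `v` to `y`. -/
theorem Connected.hasStepLength_of_critical (hG : G.Connected) (huv : G.Adj u v)
    (hxy : G.dist x y = G.dist x u + 1 + G.dist v y)
    (hcrit : (G.dist x y : ℕ∞) < (G.deleteEdges {s(u, v)}).edist x y) {j : ℕ} (hj : 1 ≤ j)
    (hj' : j ≤ G.dist v y + 1) : G.HasStepLength u v j := by
  have h1 : G.dist u v = 1 := dist_eq_one_iff_adj.2 huv
  have h1' : G.dist v u = 1 := dist_eq_one_iff_adj.2 huv.symm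
  obtain ⟨z, hvz, hzy⟩ := hG.exists_dist_eq (v := v) (y := y) (i := j - 1) (by omega)
  have huy : G.dist u y = G.dist v y + 1 := by
    have h3 : G.dist x y ≤ G.dist x u + G.dist u y := hG.dist_triangle
    have h4 : G.dist u y ≤ G.dist u v + G.dist v y := hG.dist_triangle
    omega
  have huz : G.dist u z = j := by
    have h3 : G.dist u y ≤ G.dist u z + G.dist z y := hG.dist_triangle
    have h4 : G.dist u z ≤ G.dist u v + G.dist v z := hG.dist_triangle
    omega
  refine ⟨z, ⟨huv, by omega, fun w huw hw ↦ ?_⟩, huz⟩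
  -- Otherwise `x … u w … z … y` is no longer than `dist x y`, and each of its pieces survives the
  -- deletion of `uv`.
  by_contra hwv
  have huw1 : G.dist u w = 1 := dist_eq_one_iff_adj.2 huw
  have hwu1 : G.dist w u = 1 := dist_eq_one_iff_adj.2 huw.symm
  have hxv : G.dist x y ≤ G.dist x v + G.dist v y := hG.dist_triangle
  have e1 := hG.edist_deleteEdges_le (u := u) (v := v) (a := x) (b := u) (by omega)
    (by simp only [dist_self]; omega)
  have e2 : (G.deleteEdges {s(u, v)}).edist u w ≤ 1 := edist_deleteEdges_le_one huw (by
    intro h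
    rcases Sym2.eq_iff.1 h with ⟨-, h⟩ | ⟨h, -⟩
    · exact hwv h
    · exact huv.ne h)
  have e3 := hG.edist_deleteEdges_le (u := u) (v := v) (a := w) (b := z) (by omega) (by omega)
  have hzu : G.dist z u = j := by rw [dist_comm]; exact huz
  have e4 := hG.edist_deleteEdges_le (u := u) (v := v) (a := z) (b := y) (by omega) (by omega)
  have t1 := (G.deleteEdges {s(u, v)}).edist_triangle (u := x) (v := u) (w := y)
  have t2 := (G.deleteEdges {s(u, v)}).edist_triangle (u := u) (v := w) (w := y)
  have t3 := (G.deleteEdges {s(u, v)}).edist_triangle (u := w) (v := z) (w := y)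
  have key : (G.deleteEdges {s(u, v)}).edist x y ≤
      ((G.dist x u + (1 + (G.dist w z + G.dist z y)) : ℕ) : ℕ∞) := by
    push_cast
    exact t1.trans (add_le_add e1 (t2.trans (add_le_add e2 (t3.trans (add_le_add e3 e4)))))
  have := hcrit.trans_le key
  rw [Nat.cast_lt] at this
  omega

theorem IsDiameterCritical.connected [Nonempty V] (h : G.IsDiameterCritical k) :
    G.Connected := by
  by_contra hG
  obtain ⟨u⟩ := ‹Nonempty V›
  have h2 := G.eccent_eq_top_of_not_connected hG u
  have h3 : G.eccent u ≤ G.ediam := eccent_le_ediam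
  rw [h.1, h2] at h3
  exact absurd h3 (by simp)

theorem IsDiameterCritical.dist_le [Nonempty V] (h : G.IsDiameterCritical k) (x y : V) :
    G.dist x y ≤ k := by
  have h1 : G.edist x y ≤ G.ediam := edist_le_ediam
  rw [h.1, ← (h.connected x y).coe_dist_eq_edist] at h1
  exact_mod_cast h1

/-- Every edge `uv` of a diameter-critical graph lies on all short paths between two vertices
`x` and `y`; the last inequality compares a detour around `uv` with `k`. -/
theorem IsDiameterCritical.exists_hasStepLength [Nonempty V] (h : G.IsDiameterCritical k)
    (huv : G.Adj u v) : ∃ l m : ℕ,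
      (∀ j, 1 ≤ j → j ≤ l → G.HasStepLength u v j) ∧
      (∀ j, 1 ≤ j → j ≤ m → G.HasStepLength v u j) ∧ l ≤ k ∧ m ≤ k ∧
      (k : ℕ∞) + 2 < ((l + m : ℕ) : ℕ∞) + (G.deleteEdges {s(u, v)}).edist u v := by
  have hG := h.connected
  have h0 := h.2 s(u, v) huv
  rw [ediam_eq_iSup_iSup_edist] at h0
  obtain ⟨x, h0⟩ := lt_iSup_iff.1 h0
  obtain ⟨y, h0⟩ := lt_iSup_iff.1 h0
  have hk : (G.dist x y : ℕ∞) < (G.deleteEdges {s(u, v)}).edist x y :=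
    lt_of_le_of_lt (by exact_mod_cast h.dist_le x y) h0
  have h1 : G.dist u v = 1 := dist_eq_one_iff_adj.2 huv
  have h1' : G.dist v u = 1 := dist_eq_one_iff_adj.2 huv.symm
  -- Some geodesic must use `uv`; swapping `x` and `y` if needed, it meets `u` first.
  obtain ⟨x, y, h0, hk, hxy⟩ : ∃ x y, (k : ℕ∞) < (G.deleteEdges {s(u, v)}).edist x y ∧
      (G.dist x y : ℕ∞) < (G.deleteEdges {s(u, v)}).edist x y ∧
      G.dist x y = G.dist x u + 1 + G.dist v y := by
    have t1 : G.dist x y ≤ G.dist x u + G.dist u y := hG.dist_triangle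
    have t2 : G.dist u y ≤ G.dist u v + G.dist v y := hG.dist_triangle
    have t3 : G.dist x y ≤ G.dist x v + G.dist v y := hG.dist_triangle
    have t4 : G.dist v y ≤ G.dist v u + G.dist u y := hG.dist_triangle
    by_cases hA : G.dist x y < G.dist x u + 1 + G.dist v y
    · by_cases hB : G.dist x y < G.dist x v + 1 + G.dist u y
      · exact absurd hk (hG.edist_deleteEdges_le hA hB).not_gt
      · refine ⟨y, x, by rwa [edist_comm], by rwa [dist_comm, edist_comm], ?_⟩
        rw [G.dist_comm (u := y) (v := x), G.dist_comm (u := y) (v := u),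
          G.dist_comm (u := v) (v := x)]
        omega
    · exact ⟨x, y, h0, hk, by omega⟩
  have hvy : G.dist v y + 1 ≤ k := by have := h.dist_le x y; omega
  have hxu : G.dist x u + 1 ≤ k := by have := h.dist_le x y; omega
  refine ⟨G.dist v y + 1, G.dist x u + 1,
    fun j hj hj' ↦ hG.hasStepLength_of_critical huv hxy hk hj hj', fun j hj hj' ↦ ?_, hvy, hxu, ?_⟩
  · refine hG.hasStepLength_of_critical (x := y) (y := x) huv.symm ?_ ?_ hj ?_
    · rw [G.dist_comm (u := y) (v := x), G.dist_comm (u := y) (v := v),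
        G.dist_comm (u := u) (v := x)]
      omega
    · rwa [dist_comm, edist_comm, Sym2.eq_swap]
    · rwa [G.dist_comm (u := u) (v := x)]
  -- Replacing `uv` by a detour of length `c` costs `(m - 1) + c + (l - 1)`, which must exceed `k`.
  · have t3 : G.dist x y ≤ G.dist x v + G.dist v y := hG.dist_triangle
    have t1 : G.dist x y ≤ G.dist x u + G.dist u y := hG.dist_triangle
    have e1 := hG.edist_deleteEdges_le (u := u) (v := v) (a := x) (b := u) (by omega)
      (by simp only [dist_self]; omega)
    have e2 := hG.edist_deleteEdges_le (u := u) (v := v) (a := v) (b := y) (by omega)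
      (by simp only [dist_self]; omega)
    have t1 := (G.deleteEdges {s(u, v)}).edist_triangle (u := x) (v := u) (w := y)
    have t2 := (G.deleteEdges {s(u, v)}).edist_triangle (u := u) (v := v) (w := y)
    generalize (G.deleteEdges {s(u, v)}).edist u v = c at *
    have key := h0.trans_le
      (t1.trans (add_le_add e1 (t2.trans (add_le_add le_rfl e2))))
    induction c using ENat.recTopCoe with
    | top => rw [add_top]; exact_mod_cast ENat.natCast_lt_top (k + 2)
    | coe c => norm_cast at key ⊢; omega

/-- The edges of `G` lying in no triangle of `G`. -/
def triangleFreePart (G : SimpleGraph V) : SimpleGraph V where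
  Adj u v := G.Adj u v ∧ ∀ a, G.Adj u a → ¬ G.Adj a v
  symm := ⟨fun _ _ h ↦ ⟨h.1.symm, fun a h1 h2 ↦ h.2 a h2.symm h1.symm⟩⟩
  loopless := ⟨fun _ h ↦ h.1.ne rfl⟩

/-- The edges of `G` lying in no triangle and in no 4-cycle of `G`. -/
def triangleSquareFreePart (G : SimpleGraph V) : SimpleGraph V where
  Adj u v := G.triangleFreePart.Adj u v ∧
    ∀ a b, G.Adj u a → G.Adj a b → G.Adj b v → a = v ∨ b = u
  symm := ⟨fun _ _ h ↦ ⟨h.1.symm, fun a b h1 h2 h3 ↦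
    (h.2 b a h3.symm h2.symm h1.symm).symm⟩⟩
  loopless := ⟨fun _ h ↦ h.1.ne rfl⟩

/-- The triangle is a detour of length 2; a 4-cycle gives length 3 and loses one. -/
theorem IsDiameterCritical.exists_hasStepLength_of_triangle [Nonempty V]
    (h : G.IsDiameterCritical k) (huv : G.Adj u v) (hT : ¬ G.triangleFreePart.Adj u v) :
    ∃ l m : ℕ, (∀ j, 1 ≤ j → j ≤ l → G.HasStepLength u v j) ∧
      (∀ j, 1 ≤ j → j ≤ m → G.HasStepLength v u j) ∧ l ≤ k ∧ m ≤ k ∧ k + 1 ≤ l + m := by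
  obtain ⟨l, m, hl, hm, hlk, hmk, hlm⟩ := h.exists_hasStepLength huv
  refine ⟨l, m, hl, hm, hlk, hmk, ?_⟩
  simp only [triangleFreePart, huv, true_and, not_forall, not_not] at hT
  obtain ⟨a, hua, hav⟩ := hT
  have e1 : (G.deleteEdges {s(u, v)}).edist u a ≤ 1 :=
    edist_deleteEdges_le_one hua (by simp [hav.ne, huv.ne])
  have e2 : (G.deleteEdges {s(u, v)}).edist a v ≤ 1 :=
    edist_deleteEdges_le_one hav (by simp [hua.ne', huv.ne'])
  have t := (G.deleteEdges {s(u, v)}).edist_triangle (u := u) (v := a) (w := v)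
  have := hlm.trans_le (add_le_add le_rfl (t.trans (add_le_add e1 e2)))
  norm_cast at this
  omega

theorem IsDiameterCritical.exists_hasStepLength_of_square [Nonempty V]
    (h : G.IsDiameterCritical k) (huv : G.Adj u v) (hT : ¬ G.triangleSquareFreePart.Adj u v) :
    ∃ l m : ℕ, (∀ j, 1 ≤ j → j ≤ l → G.HasStepLength u v j) ∧
      (∀ j, 1 ≤ j → j ≤ m → G.HasStepLength v u j) ∧ l ≤ k ∧ m ≤ k ∧ k ≤ l + m := by
  by_cases hT' : G.triangleFreePart.Adj u v
  · obtain ⟨l, m, hl, hm, hlk, hmk, hlm⟩ := h.exists_hasStepLength huv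
    refine ⟨l, m, hl, hm, hlk, hmk, ?_⟩
    simp only [triangleSquareFreePart, hT', true_and, not_forall, not_or] at hT
    obtain ⟨a, b, hua, hab, hbv, hav, hbu⟩ := hT
    have e1 : (G.deleteEdges {s(u, v)}).edist u a ≤ 1 :=
      edist_deleteEdges_le_one hua (by simp [hav, huv.ne])
    have e2 : (G.deleteEdges {s(u, v)}).edist a b ≤ 1 :=
      edist_deleteEdges_le_one hab (by simp [hua.ne', hav])
    have e3 : (G.deleteEdges {s(u, v)}).edist b v ≤ 1 :=
      edist_deleteEdges_le_one hbv (by simp [hbu, huv.ne'])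
    have t := (G.deleteEdges {s(u, v)}).edist_triangle (u := u) (v := a) (w := v)
    have t' := (G.deleteEdges {s(u, v)}).edist_triangle (u := a) (v := b) (w := v)
    have := hlm.trans_le (add_le_add le_rfl
      (t.trans (add_le_add e1 (t'.trans (add_le_add e2 e3)))))
    norm_cast at this
    omega
  · obtain ⟨l, m, hl, hm, hlk, hmk, hlm⟩ := h.exists_hasStepLength_of_triangle huv hT'
    exact ⟨l, m, hl, hm, hlk, hmk, by omega⟩

end UniqueStep

/-! ### Counting tools: Ruzsa–Szemerédi, 4-cycle-free graphs, two-edge paths. -/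

section Counting

open TripartiteFromTriangles in
/-- The Ruzsa–Szemerédi theorem: a tripartite graph on `3n` vertices whose triangles are edge
disjoint has `o(n ^ 2)` triangles. -/
theorem exists_forall_card_le_of_noAccidental {ε : ℝ} (hε : 0 < ε) : ∃ N : ℕ,
    ∀ (V : Type*) [Fintype V], N ≤ Fintype.card V → ∀ t : Finset (V × V × V),
      ExplicitDisjoint t → NoAccidental t → (#t : ℝ) ≤ ε * (Fintype.card V : ℝ) ^ 2 := by
  classical
  -- The division by 9 compensates for `(3n)²`, and 27 below is `3³`.
  have hc := triangleRemovalBound_pos (ε := ε / 9) (by positivity)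
  obtain ⟨N, hN⟩ := exists_nat_gt (1 / (27 * triangleRemovalBound (ε / 9)))
  refine ⟨N, fun V _ hV t h₁ h₂ ↦ ?_⟩
  by_contra! hlt
  have hN0 : (0 : ℝ) < N := lt_trans (by positivity) hN
  have hn : (N : ℝ) ≤ Fintype.card V := by exact_mod_cast hV
  set n : ℝ := ((Fintype.card V : ℕ) : ℝ) with hndef
  have hfar : (graph t).FarFromTriangleFree (ε / 9) :=
    farFromTriangleFree t (by push_cast; rw [← hndef]; nlinarith)
  have hle := hfar.le_card_cliqueFinset
  rw [card_triangles] at hle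
  have ht : (#t : ℝ) ≤ n ^ 2 := by
    have : #t ≤ #(univ : Finset (V × V)) := by
      refine card_le_card_of_injOn (fun x ↦ (x.1, x.2.1)) (fun _ _ ↦ mem_univ _) ?_
      rintro ⟨a, b, c⟩ hx ⟨a', b', c'⟩ hx' h
      obtain ⟨rfl, rfl⟩ := Prod.mk.inj h
      exact congrArg (fun c ↦ (a, b, c)) (h₁.inj₂ hx hx')
    rw [card_univ, Fintype.card_prod] at this
    rw [hndef, sq]
    exact_mod_cast this
  have hcard : (Fintype.card (V ⊕ V ⊕ V) : ℝ) = 3 * n := by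
    simp only [Fintype.card_sum, Nat.cast_add, ← hndef]; ring
  rw [hcard] at hle
  rw [div_lt_iff₀ (by positivity)] at hN
  have hn0 : 0 < n := hN0.trans_le hn
  have h1 : 1 < n * (27 * triangleRemovalBound (ε / 9)) := hN.trans_le (by gcongr)
  have h2 : n ^ 2 * 1 < n ^ 2 * (n * (27 * triangleRemovalBound (ε / 9))) := by gcongr
  linarith [hle.trans ht]

variable {V : Type*} [Fintype V] (H : SimpleGraph V) [DecidableRel H.Adj]

theorem sum_degree_le_card_sq : ∑ v, H.degree v ≤ Fintype.card V ^ 2 := by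
  calc ∑ v, H.degree v ≤ ∑ _v : V, Fintype.card V :=
        sum_le_sum fun v _ ↦ (H.degree_lt_card_verts v).le
    _ = Fintype.card V ^ 2 := by simp [sq]

/-- A graph without 4-cycles has `O(n ^ {3/2})` edges. -/
theorem sq_sum_degree_le
    (hH : ∀ a b v w, a ≠ b → H.Adj v a → H.Adj v b → H.Adj w a → H.Adj w b → v = w) :
    (∑ v, H.degree v) ^ 2 ≤ 2 * Fintype.card V ^ 3 := by
  classical
  -- Two distinct vertices have at most one common neighbour.
  have h1 : ∑ v, #(H.neighborFinset v).offDiag ≤ Fintype.card V ^ 2 := by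
    rw [← card_biUnion]
    · exact (card_le_univ _).trans (by simp [sq])
    · intro v _ w _ hvw
      rw [Function.onFun, Finset.disjoint_left]
      rintro ⟨a, b⟩ h h'
      simp only [mem_offDiag, mem_neighborFinset] at h h'
      exact hvw (hH a b v w h.2.2 h.1 h.2.1 h'.1 h'.2.1)
  have h2 : ∑ v, H.degree v ^ 2 =
      ∑ v, #(H.neighborFinset v).offDiag + ∑ v, H.degree v := by
    rw [← sum_add_distrib]
    refine sum_congr rfl fun v _ ↦ ?_
    rw [offDiag_card, card_neighborFinset_eq_degree, sq]
    exact (Nat.sub_add_cancel (Nat.le_mul_self _)).symm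
  calc (∑ v, H.degree v) ^ 2 ≤ #(univ : Finset V) * ∑ v, H.degree v ^ 2 :=
        sq_sum_le_card_mul_sum_sq
    _ ≤ Fintype.card V * (Fintype.card V ^ 2 + Fintype.card V ^ 2) := by
        rw [h2, card_univ]
        gcongr
        exact H.sum_degree_le_card_sq
    _ = 2 * Fintype.card V ^ 3 := by ring

/-- Suppose that `U` contains the ends `(v, b)` of all paths `v w b` of `H`, except that for each
`(v, w)` one vertex `b = g v w` and for each `(b, w)` one vertex `v = g b w` may be left out.
Then `U` is not much smaller than the number of ordered pairs of adjacent vertices. -/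
theorem sum_degree_sub_le_card_of_paths {U : Finset (V × V)} (g : V → V → V)
    (hU : ∀ v w b, H.Adj v w → H.Adj w b → b ≠ v → b ≠ g v w → v ≠ g b w → (v, b) ∈ U)
    {D : ℝ} (hD : 0 < D) :
    (∑ v, H.degree v : ℝ) - 2 * Fintype.card V * D - (∑ v, H.degree v : ℝ) / D -
      2 * Fintype.card V ≤ #U := by
  classical
  set d : V → ℝ := fun v ↦ H.degree v with hd
  set c : V → V → ℝ := fun v w ↦ #{b ∈ H.neighborFinset w | g b w = v} with hc
  set s : V → V → ℝ := fun v w ↦ if H.Adj v w then 1 else 0 with hs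
  -- Only edges with both degrees at least `D` are kept, so that dividing by `d v` keeps the
  -- exceptions `c` small.
  set r : V → V → ℝ := fun v w ↦ if H.Adj v w ∧ D ≤ d v ∧ D ≤ d w then 1 else 0 with hr
  set Uv : V → Finset V := fun v ↦ {b | (v, b) ∈ U} with hUv
  have hssymm : ∀ v w, s v w = s w v := fun v w ↦ by simp only [hs, H.adj_comm]
  have hrsymm : ∀ v w, r v w = r w v := fun v w ↦ by
    simp only [hr, H.adj_comm v w, and_comm (a := D ≤ d v)]
  have hr0 : ∀ v w, 0 ≤ r v w := fun v w ↦ by simp only [hr]; split_ifs <;> norm_num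
  have hrs : ∀ v w, r v w ≤ s v w := fun v w ↦ by
    simp only [hr, hs]; split_ifs <;> first | (norm_num; done) | tauto
  have hsd : ∀ v, ∑ w, s v w = d v := fun v ↦ by
    simp only [hs, hd]
    rw [sum_boole, ← card_neighborFinset_eq_degree, neighborFinset_eq_filter]
  have hUsum : ∑ v, (#(Uv v) : ℝ) = #U := by
    rw [← Nat.cast_sum, Nat.cast_inj, card_eq_sum_card_fiberwise (f := Prod.fst) (t := univ)
      (fun _ _ ↦ mem_univ _)]
    refine sum_congr rfl fun v _ ↦ ?_
    refine card_bij (fun b _ ↦ (v, b)) ?_ ?_ ?_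
    · intro b hb; simpa [hUv] using hb
    · intro b _ b' _ h; exact (Prod.mk.inj h).2
    · rintro ⟨a, b⟩ h
      simp only [mem_filter] at h
      obtain ⟨h, rfl⟩ := h
      exact ⟨b, by simpa [hUv] using h, rfl⟩
  have hlocal : ∀ v w, H.Adj v w → d w - c v w ≤ #(Uv v) + 2 := fun v w hvw ↦ by
    have hsub : H.neighborFinset w ⊆
        (Uv v ∪ {v, g v w}) ∪ {b ∈ H.neighborFinset w | g b w = v} := by
      intro b hb
      simp only [mem_union, mem_insert, mem_singleton, mem_filter, hb, true_and, hUv, mem_univ]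
      rw [mem_neighborFinset] at hb
      by_contra! hcon
      exact hcon.1.1 (hU v w b hvw hb hcon.1.2.1 hcon.1.2.2 hcon.2.symm)
    have h1 := (card_le_card hsub).trans ((card_union_le _ _).trans
      (Nat.add_le_add_right ((card_union_le _ _).trans
        (Nat.add_le_add_left card_le_two _)) _))
    rw [card_neighborFinset_eq_degree] at h1
    have h2 : (H.degree w : ℝ) ≤
        #(Uv v) + 2 + #{b ∈ H.neighborFinset w | g b w = v} := by exact_mod_cast h1
    simp only [hd, hc]
    linarith
  -- The local bound at `v` is averaged over its neighbours.
  have hupper : ∑ v, ∑ w, r v w * ((d w - c v w) / d v) ≤ #U + 2 * Fintype.card V := by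
    have h1 : ∀ v, ∑ w, r v w * ((d w - c v w) / d v) ≤ #(Uv v) + 2 := fun v ↦ by
      have hd0 : 0 ≤ d v := Nat.cast_nonneg _
      calc ∑ w, r v w * ((d w - c v w) / d v)
          ≤ ∑ w, s v w * ((#(Uv v) + 2) / d v) := by
            refine sum_le_sum fun w _ ↦ ?_
            by_cases hvw : H.Adj v w
            · calc r v w * ((d w - c v w) / d v) ≤ r v w * ((#(Uv v) + 2) / d v) := by
                    have := hlocal v w hvw
                    have := hr0 v w
                    gcongr
                _ ≤ s v w * ((#(Uv v) + 2) / d v) := by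
                    have := hrs v w
                    gcongr
            · simp [hr, hs, hvw]
        _ = d v * ((#(Uv v) + 2) / d v) := by rw [← sum_mul, hsd]
        _ ≤ #(Uv v) + 2 := by
            rcases hd0.eq_or_lt with h | h
            · rw [← h, zero_mul]; positivity
            · exact (mul_div_cancel₀ _ h.ne').le
    calc _ ≤ ∑ v, ((#(Uv v) : ℝ) + 2) := sum_le_sum fun v _ ↦ h1 v
      _ = #U + 2 * Fintype.card V := by
        rw [sum_add_distrib, hUsum]; simp [mul_comm]
  -- Pairing `(v, w)` with `(w, v)` and using `t + 1/t ≥ 2`.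
  have hratio : ∑ v, ∑ w, r v w ≤ ∑ v, ∑ w, r v w * (d w / d v) := by
    have h1 : ∑ v, ∑ w, r v w * (d w / d v) = ∑ v, ∑ w, r v w * (d v / d w) := by
      rw [sum_comm]
      exact sum_congr rfl fun v _ ↦ sum_congr rfl fun w _ ↦ by rw [hrsymm]
    have h2 : ∑ v, ∑ w, 2 * r v w ≤
        ∑ v, ∑ w, (r v w * (d w / d v) + r v w * (d v / d w)) := by
      refine sum_le_sum fun v _ ↦ sum_le_sum fun w _ ↦ ?_
      simp only [hr]
      split_ifs with h
      · have hv : 0 < d v := hD.trans_le h.2.1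
        have hw : 0 < d w := hD.trans_le h.2.2
        rw [one_mul, one_mul, mul_one, div_add_div _ _ hv.ne' hw.ne',
          le_div_iff₀ (by positivity)]
        nlinarith [sq_nonneg (d v - d w)]
      · simp
    simp only [sum_add_distrib, ← mul_sum] at h2
    rw [← h1] at h2
    linarith
  have hcsum : ∑ v, ∑ w, c v w = ∑ v, d v := by
    rw [sum_comm]
    refine sum_congr rfl fun w _ ↦ ?_
    simp only [hc, hd]
    rw [← Nat.cast_sum, Nat.cast_inj, ← card_neighborFinset_eq_degree]
    exact (card_eq_sum_card_fiberwise fun _ _ ↦ mem_univ _).symm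
  have herr : ∑ v, ∑ w, r v w * (c v w / d v) ≤ (∑ v, d v) / D := by
    rw [← hcsum, sum_div]
    refine sum_le_sum fun v _ ↦ ?_
    rw [sum_div]
    refine sum_le_sum fun w _ ↦ ?_
    have hc0 : 0 ≤ c v w := Nat.cast_nonneg _
    simp only [hr]
    split_ifs with h
    · rw [one_mul]
      exact div_le_div_of_nonneg_left hc0 hD h.2.1
    · rw [zero_mul]; positivity
  -- Each vertex of degree below `D` spoils fewer than `D` edges, counted from either end.
  have hlow : ∑ v, d v - 2 * Fintype.card V * D ≤ ∑ v, ∑ w, r v w := by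
    set q : V → ℝ := fun v ↦ if D ≤ d v then 0 else 1 with hq
    have h1 : ∀ v w, s v w ≤ r v w + q v * s v w + q w * s w v := fun v w ↦ by
      rw [hssymm w v]
      simp only [hr, hs, hq]
      split_ifs <;> first | (norm_num; done) | tauto
    have h2 : ∑ v, ∑ w, q v * s v w ≤ Fintype.card V * D := by
      calc ∑ v, ∑ w, q v * s v w ≤ ∑ _v : V, D := by
            refine sum_le_sum fun v _ ↦ ?_
            rw [← mul_sum, hsd]
            simp only [hq]
            split_ifs with h
            · rw [zero_mul]; exact hD.le
            · rw [one_mul]; exact (not_le.1 h).le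
        _ = Fintype.card V * D := by simp
    have h3 : ∑ v, ∑ w, q w * s w v ≤ Fintype.card V * D := by rw [sum_comm]; exact h2
    have h4 := sum_le_sum fun v (_ : v ∈ univ) ↦ sum_le_sum fun w (_ : w ∈ univ) ↦ h1 v w
    simp only [sum_add_distrib, hsd] at h4
    linarith
  have hsplit : ∑ v, ∑ w, r v w * ((d w - c v w) / d v) =
      ∑ v, ∑ w, r v w * (d w / d v) - ∑ v, ∑ w, r v w * (c v w / d v) := by
    simp only [sub_div, mul_sub, sum_sub_distrib]
  linarith

end Counting

/-! ### Chosen pairs: charging edges and bounding overlaps. -/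

section StepPairs

variable {V : Type*} {G : SimpleGraph V} {u v w y : V} {j k : ℕ}

open Classical in
/-- A vertex at distance `j` from `u` all of whose geodesics from `u` start with `uv`. -/
noncomputable def stepEnd (G : SimpleGraph V) (u v : V) (j : ℕ) : V :=
  if h : G.HasStepLength u v j then h.choose else u

theorem HasStepLength.stepEnd_spec (h : G.HasStepLength u v j) :
    G.IsUniqueStep u v (G.stepEnd u v j) ∧ G.dist u (G.stepEnd u v j) = j := by
  rw [stepEnd, dif_pos h]
  exact h.choose_spec

/-- The pair `(u, y)` is the one chosen for the first edge of its geodesics and its distance. -/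
def IsStepPair (G : SimpleGraph V) (u y : V) : Prop :=
  ∃ v, G.IsUniqueStep u v y ∧ G.stepEnd u v (G.dist u y) = y

theorem IsStepPair.stepEnd_eq (h : G.IsStepPair u y) (huv : G.IsUniqueStep u v y) :
    G.stepEnd u v (G.dist u y) = y := by
  obtain ⟨w, hw, h⟩ := h
  rwa [huv.eq hw]

theorem IsStepPair.dist_pos (h : G.IsStepPair u y) : 1 ≤ G.dist u y := by
  obtain ⟨w, hw, -⟩ := h
  have := hw.2.1
  omega

/-- A geodesic from `y` to `v` extends through `vu` to one ending at `u`, so its first step is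
already forced. -/
theorem IsUniqueStep.unique_of_dist_add (hG : G.Connected) (h : G.IsUniqueStep y w u)
    (hv : G.dist y u = G.dist y v + 1) (huv : G.Adj u v) {z : V} (hyz : G.Adj y z)
    (hz : G.dist z v < G.dist y v) : z = w := by
  have h1 : G.dist z u ≤ G.dist z v + G.dist v u := hG.dist_triangle
  have h2 : G.dist v u = 1 := dist_eq_one_iff_adj.2 huv.symm
  exact h.2.2 z hyz (by omega)

variable [Fintype V]

open Classical in
/-- The pairs at distance `d` that are chosen from both ends. -/
noncomputable def doubleStepPairs (G : SimpleGraph V) (d : ℕ) : Finset (V × V) :=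
  {p | G.IsStepPair p.1 p.2 ∧ G.IsStepPair p.2 p.1 ∧ G.dist p.1 p.2 = d}

-- Each such pair `(u, y)` becomes a triangle `(u, v, y)` with `v` the forced first step. Choice
-- from both ends makes these triangles edge-disjoint; the common distance `d` excludes accidental
-- ones.
open TripartiteFromTriangles in
theorem exists_forall_card_doubleStepPairs_le {ε : ℝ} (hε : 0 < ε) : ∃ N : ℕ,
    ∀ (V : Type*) [Fintype V], N ≤ Fintype.card V → ∀ G : SimpleGraph V, G.Connected →
      ∀ d, 2 ≤ d → (#(G.doubleStepPairs d) : ℝ) ≤ ε * (Fintype.card V : ℝ) ^ 2 := by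
  classical
  obtain ⟨N, hN⟩ := exists_forall_card_le_of_noAccidental hε
  refine ⟨N, fun V _ hV G hG d hd ↦ ?_⟩
  set t : Finset (V × V × V) := {x | G.IsUniqueStep x.1 x.2.1 x.2.2 ∧
    G.IsStepPair x.1 x.2.2 ∧ G.IsStepPair x.2.2 x.1 ∧ G.dist x.1 x.2.2 = d} with ht
  have hmem : ∀ a b c, (a, b, c) ∈ t ↔ G.IsUniqueStep a b c ∧ G.IsStepPair a c ∧
      G.IsStepPair c a ∧ G.dist a c = d := fun a b c ↦ by simp [ht]
  have hdisj : ExplicitDisjoint t := by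
    refine ⟨fun u v y u' h h' ↦ ?_, fun u v y v' h h' ↦ ?_, fun u v y y' h h' ↦ ?_⟩
    -- Since `d ≥ 2`, `v ≠ y`, so the first step from `y` towards `v` determines the first step
    -- towards both `u` and `u'`.
    · rw [hmem] at h h'
      obtain ⟨w, hw, hwu⟩ := h.2.2.1
      obtain ⟨w', hw', hwu'⟩ := h'.2.2.1
      have hyu : G.dist y u = d := by rw [dist_comm]; exact h.2.2.2
      have hyu' : G.dist y u' = d := by rw [dist_comm]; exact h'.2.2.2
      have hyv : G.dist y v + 1 = d := by
        rw [dist_comm, ← h.1.2.1]; exact h.2.2.2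
      obtain ⟨z, hyz, hzv⟩ := hG.exists_dist_eq (v := y) (y := v) (i := 1) (by omega)
      have hyz := dist_eq_one_iff_adj.1 hyz
      have e := hw.unique_of_dist_add hG (v := v) (by omega) h.1.1 hyz (by omega)
      have e' := hw'.unique_of_dist_add hG (v := v) (by omega) h'.1.1 hyz (by omega)
      rw [← hwu, ← hwu', ← e, ← e', hyu, hyu']
    · rw [hmem] at h h'
      exact h.1.eq h'.1
    · rw [hmem] at h h'
      rw [← h.2.1.stepEnd_eq h.1, ← h'.2.1.stepEnd_eq h'.1, h.2.2.2, h'.2.2.2]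
  have hacc : NoAccidental t := by
    -- Here `b` is a neighbour of `a` at distance `d - 1` from `c`, hence the forced step `b'`.
    refine ⟨fun a a' b b' c c' h₀ h₁ h₂ ↦ Or.inr (Or.inl ?_)⟩
    rw [hmem] at h₀ h₁ h₂
    exact h₁.1.2.2 b h₂.1.1 (by have := h₀.1.2.1; omega)
  refine le_trans ?_ (hN V hV t hdisj hacc)
  rw [Nat.cast_le]
  refine (card_le_card ?_).trans (card_image_le (s := t) (f := fun x ↦ (x.1, x.2.2)))
  rintro ⟨u, y⟩ h
  simp only [doubleStepPairs, mem_filter, mem_univ, true_and] at h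
  obtain ⟨v, hv, -⟩ := id h.1
  exact mem_image.2 ⟨(u, v, y), (hmem _ _ _).2 ⟨hv, h⟩, rfl⟩

theorem card_adj_eq_sum_degree (H : SimpleGraph V) [DecidableRel H.Adj] :
    #{p : V × V | H.Adj p.1 p.2} = ∑ v, H.degree v := by
  rw [card_filter, Fintype.sum_prod_type]
  refine sum_congr rfl fun v _ ↦ ?_
  rw [← card_filter, ← card_neighborFinset_eq_degree, neighborFinset_eq_filter]

-- The chosen end determines `v`, as the forced first step, and `j`, as the distance.
open Classical in
theorem sum_card_hasStepLength_le :
    ∑ u : V, ∑ v : V, #{j ∈ Icc 1 k | G.HasStepLength u v j} ≤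
      #{p : V × V | G.IsStepPair p.1 p.2} := by
  set K : Finset (V × V × ℕ) := {x ∈ univ ×ˢ univ ×ˢ Icc 1 k | G.HasStepLength x.1 x.2.1 x.2.2}
    with hK
  have h1 : ∑ u : V, ∑ v : V, #{j ∈ Icc 1 k | G.HasStepLength u v j} = #K := by
    simp only [hK, card_filter, sum_product]
  rw [h1]
  refine card_le_card_of_injOn (fun x ↦ (x.1, G.stepEnd x.1 x.2.1 x.2.2)) ?_ ?_
  · rintro ⟨u, v, j⟩ hx
    have hx := (mem_filter.1 hx).2.stepEnd_spec
    simp only [coe_filter, mem_univ, true_and, Set.mem_ofPred_eq]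
    exact ⟨v, hx.1, by rw [hx.2]⟩
  · rintro ⟨u, v, j⟩ hx ⟨u', v', j'⟩ hx' h
    have hx := (mem_filter.1 hx).2.stepEnd_spec
    have hx' := (mem_filter.1 hx').2.stepEnd_spec
    simp only [Prod.mk.injEq] at h hx hx'
    obtain ⟨rfl, h⟩ := h
    rw [← h] at hx'
    obtain rfl := hx.1.eq hx'.1
    rw [← hx.2, ← hx'.2]

-- An ordered edge receives `l + m` charges; `T` and `kS` make up any shortfall from `k + 1`.
open Classical in
theorem IsDiameterCritical.mul_sum_degree_le [Nonempty V] (h : G.IsDiameterCritical k) :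
    (k + 1) * ∑ v, G.degree v ≤ 2 * #{p : V × V | G.IsStepPair p.1 p.2} +
      ∑ v, G.triangleFreePart.degree v + k * ∑ v, G.triangleSquareFreePart.degree v := by
  have hdeg : ∀ H : SimpleGraph V,
      ∑ v, H.degree v = ∑ u : V, ∑ v : V, if H.Adj u v then 1 else 0 := fun H ↦ by
    rw [← card_adj_eq_sum_degree, card_filter, Fintype.sum_prod_type]
  have hstep : ∀ u v l, l ≤ k → (∀ j, 1 ≤ j → j ≤ l → G.HasStepLength u v j) →
      l ≤ #{j ∈ Icc 1 k | G.HasStepLength u v j} := fun u v l hl hj ↦ by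
    calc l = #(Icc 1 l) := by simp
      _ ≤ _ := card_le_card fun j hmem ↦ by
        rw [mem_Icc] at hmem
        exact mem_filter.2 ⟨mem_Icc.2 ⟨hmem.1, hmem.2.trans hl⟩, hj j hmem.1 hmem.2⟩
  have hlocal : ∀ u v : V, (k + 1) * (if G.Adj u v then 1 else 0) ≤
      #{j ∈ Icc 1 k | G.HasStepLength u v j} + #{j ∈ Icc 1 k | G.HasStepLength v u j} +
        (if G.triangleFreePart.Adj u v then 1 else 0) +
        k * (if G.triangleSquareFreePart.Adj u v then 1 else 0) := fun u v ↦ by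
    by_cases huv : G.Adj u v
    · rw [if_pos huv]
      by_cases hT : G.triangleFreePart.Adj u v
      · rw [if_pos hT]
        by_cases hS : G.triangleSquareFreePart.Adj u v
        · rw [if_pos hS]; omega
        · obtain ⟨l, m, hl, hm, hlk, hmk, hlm⟩ := h.exists_hasStepLength_of_square huv hS
          have := hstep u v l hlk hl
          have := hstep v u m hmk hm
          omega
      · obtain ⟨l, m, hl, hm, hlk, hmk, hlm⟩ := h.exists_hasStepLength_of_triangle huv hT
        have := hstep u v l hlk hl
        have := hstep v u m hmk hm
        omega
    · rw [if_neg huv]; omega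
  have hsum := sum_le_sum fun u (_ : u ∈ univ) ↦ sum_le_sum fun v (_ : v ∈ univ) ↦ hlocal u v
  simp only [sum_add_distrib, ← mul_sum, ← hdeg] at hsum
  rw [sum_comm (f := fun u v ↦ #{j ∈ Icc 1 k | G.HasStepLength v u j})] at hsum
  have := sum_card_hasStepLength_le (G := G) (k := k)
  omega

open Classical in
theorem IsDiameterCritical.card_double_le [Nonempty V] (h : G.IsDiameterCritical k) :
    #{p : V × V | G.IsStepPair p.1 p.2 ∧ G.IsStepPair p.2 p.1} ≤
      ∑ v, G.degree v + ∑ d ∈ Icc 2 k, #(G.doubleStepPairs d) := by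
  rw [← card_adj_eq_sum_degree]
  refine (card_le_card (t := ({p : V × V | G.Adj p.1 p.2} : Finset (V × V)) ∪
    (Icc 2 k).biUnion G.doubleStepPairs) ?_).trans
    ((card_union_le _ _).trans (Nat.add_le_add_left card_biUnion_le _))
  rintro ⟨u, y⟩ hp
  simp only [mem_filter, mem_univ, true_and, mem_union, mem_biUnion, mem_Icc] at hp ⊢
  by_cases h1 : G.dist u y = 1
  · exact Or.inl (dist_eq_one_iff_adj.1 h1)
  · have := hp.1.dist_pos
    exact Or.inr ⟨G.dist u y, ⟨by omega, h.dist_le u y⟩, by simp [doubleStepPairs, hp]⟩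

open Classical in
theorem card_sq_eq_add_card_isStepPair : Fintype.card V ^ 2 +
    #{p : V × V | G.IsStepPair p.1 p.2 ∧ G.IsStepPair p.2 p.1} =
      2 * #{p : V × V | G.IsStepPair p.1 p.2} +
        #{p : V × V | ¬ (G.IsStepPair p.1 p.2 ∨ G.IsStepPair p.2 p.1)} := by
  have h1 : #{p : V × V | G.IsStepPair p.2 p.1} = #{p : V × V | G.IsStepPair p.1 p.2} :=
    card_bij (fun p _ ↦ p.swap) (by simp) (fun _ _ _ _ h ↦ Prod.swap_injective h)
      (fun p hp ↦ ⟨p.swap, by simpa using hp, by simp⟩)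
  have h2 := card_filter_add_card_filter_not (s := (univ : Finset (V × V)))
    (fun p ↦ G.IsStepPair p.1 p.2 ∨ G.IsStepPair p.2 p.1)
  have h3 := card_union_add_card_inter ({p : V × V | G.IsStepPair p.1 p.2} : Finset (V × V))
    {p : V × V | G.IsStepPair p.2 p.1}
  rw [← filter_or, ← filter_and] at h3
  rw [card_univ, Fintype.card_prod] at h2
  rw [sq]
  omega

-- A path `v w b` outside triangles is a geodesic, so `(v, b)` can be chosen only as the single end
-- selected for `(v, w, 2)`.
open Classical in
theorem Connected.sum_degree_triangleFreePart_le (hG : G.Connected) {D : ℝ} (hD : 0 < D) :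
    (∑ v, G.triangleFreePart.degree v : ℝ) - 2 * Fintype.card V * D -
      (∑ v, G.triangleFreePart.degree v : ℝ) / D - 2 * Fintype.card V ≤
      #{p : V × V | ¬ (G.IsStepPair p.1 p.2 ∨ G.IsStepPair p.2 p.1)} := by
  refine sum_degree_sub_le_card_of_paths _ (fun v w ↦ G.stepEnd v w 2) ?_ hD
  intro v w b hvw hwb hbv hb hv
  have hvw1 := dist_eq_one_iff_adj.2 hvw.1
  have hwb1 := dist_eq_one_iff_adj.2 hwb.1
  have hwv1 := dist_eq_one_iff_adj.2 hvw.1.symm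
  have hvb : G.dist v b = 2 := by
    have h1 : G.dist v b ≤ G.dist v w + G.dist w b := hG.dist_triangle
    have h2 := hG.one_lt_dist_of_ne_of_not_adj hbv.symm fun h ↦ hvw.2 b h hwb.1.symm
    omega
  have hbv2 : G.dist b v = 2 := by rwa [dist_comm]
  simp only [mem_filter, mem_univ, true_and, not_or]
  refine ⟨?_, ?_⟩
  · rintro ⟨z, hz, h⟩
    rw [← hz.2.2 w hvw.1 (by omega), hvb] at h
    exact hb h.symm
  · rintro ⟨z, hz, h⟩
    rw [← hz.2.2 w hwb.1.symm (by omega), hbv2] at h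
    exact hv h.symm

open Classical in
theorem sq_sum_degree_triangleSquareFreePart_le :
    (∑ v, G.triangleSquareFreePart.degree v) ^ 2 ≤ 2 * Fintype.card V ^ 3 := by
  refine sq_sum_degree_le _ fun a b v w hab hva hvb hwa hwb ↦ ?_
  rcases hva.2 b w hvb.1.1 hwb.1.1.symm hwa.1.1 with h | h
  · exact absurd h.symm hab
  · exact h.symm

end StepPairs

/-! ### Assembling the estimates. -/

/-- Up to `o(n ^ 2)`, uniformly in `k`, a diameter-`k`-critical graph has at most `n ^ 2 / (2 * k)`
edges. -/
theorem exists_forall_card_edgeFinset_le {ε : ℝ} (hε : 0 < ε) : ∃ N : ℕ, ∀ k : ℕ, 1 ≤ k →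
    ∀ (V : Type*) [Fintype V] (G : SimpleGraph V) [Fintype G.edgeSet], N ≤ Fintype.card V →
      G.IsDiameterCritical k → (#G.edgeFinset : ℝ) ≤
        (Fintype.card V : ℝ) ^ 2 / (2 * (k : ℝ)) + ε * (Fintype.card V : ℝ) ^ 2 := by
  classical
  obtain ⟨δ, hδ, rfl⟩ : ∃ δ : ℝ, 0 < δ ∧ 3 * δ = ε := ⟨ε / 3, by positivity, by ring⟩
  obtain ⟨N₁, hN₁⟩ := exists_forall_card_doubleStepPairs_le hδ
  -- `N₂` ensures `S ≤ δn²`; `N₃` ensures `n/δ + 2n ≤ 2δn²`.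
  obtain ⟨N₂, hN₂⟩ := exists_nat_ge (2 / δ ^ 2)
  obtain ⟨N₃, hN₃⟩ := exists_nat_ge ((1 / δ + 2) / (2 * δ))
  refine ⟨max (max N₁ N₂) (max N₃ 1), fun k hk V _ G _ hV h ↦ ?_⟩
  simp only [max_le_iff] at hV
  obtain ⟨⟨hV₁, hV₂⟩, hV₃, hV₄⟩ := hV
  have : Nonempty V := Fintype.card_pos_iff.1 hV₄
  set n : ℝ := ((Fintype.card V : ℕ) : ℝ) with hn
  have hn2 : 2 / δ ^ 2 ≤ n := hN₂.trans (by rw [hn]; exact_mod_cast hV₂)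
  have hn3 : (1 / δ + 2) / (2 * δ) ≤ n := hN₃.trans (by rw [hn]; exact_mod_cast hV₃)
  have hn0 : 0 < n := by rw [hn]; exact_mod_cast hV₄
  have hkR : (1 : ℝ) ≤ k := by exact_mod_cast hk
  have hA : (∑ v, G.degree v : ℝ) = 2 * #G.edgeFinset := by
    have := G.sum_degrees_eq_twice_card_edges
    rw [← Nat.cast_sum, this]
    push_cast
    congr!
  set A : ℝ := ∑ v, (G.degree v : ℝ) with hAdef
  set T : ℝ := ∑ v, (G.triangleFreePart.degree v : ℝ) with hT
  set S : ℝ := ∑ v, (G.triangleSquareFreePart.degree v : ℝ) with hS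
  have h1 : (k + 1) * A ≤ 2 * (#{p : V × V | G.IsStepPair p.1 p.2} : ℝ) + T + k * S := by
    rw [hAdef, hT, hS]; exact_mod_cast h.mul_sum_degree_le
  have h2 : (#{p : V × V | G.IsStepPair p.1 p.2 ∧ G.IsStepPair p.2 p.1} : ℝ) ≤
      A + k * (δ * n ^ 2) := by
    have h3 : ∑ d ∈ Icc 2 k, (#(G.doubleStepPairs d) : ℝ) ≤ k * (δ * n ^ 2) := by
      calc _ ≤ ∑ d ∈ Icc 2 k, δ * n ^ 2 := sum_le_sum fun d hd ↦
            hN₁ V hV₁ G h.connected d (mem_Icc.1 hd).1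
        _ = ((k - 1 : ℕ) : ℝ) * (δ * n ^ 2) := by simp
        _ ≤ k * (δ * n ^ 2) := by
            gcongr
            exact Nat.sub_le k 1
    have h4 : (#{p : V × V | G.IsStepPair p.1 p.2 ∧ G.IsStepPair p.2 p.1} : ℝ) ≤
        A + ∑ d ∈ Icc 2 k, (#(G.doubleStepPairs d) : ℝ) := by
      rw [hAdef]; exact_mod_cast h.card_double_le
    linarith
  have h3 : n ^ 2 + (#{p : V × V | G.IsStepPair p.1 p.2 ∧ G.IsStepPair p.2 p.1} : ℝ) =
      2 * (#{p : V × V | G.IsStepPair p.1 p.2} : ℝ) +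
        #{p : V × V | ¬ (G.IsStepPair p.1 p.2 ∨ G.IsStepPair p.2 p.1)} := by
    rw [hn]; exact_mod_cast card_sq_eq_add_card_isStepPair
  have h4 := h.connected.sum_degree_triangleFreePart_le (D := δ * n) (by positivity)
  rw [← hT, ← hn] at h4
  have hTn : T / (δ * n) ≤ n / δ := by
    have : T ≤ n ^ 2 := by
      rw [hT, hn]; exact_mod_cast G.triangleFreePart.sum_degree_le_card_sq
    rw [div_le_div_iff₀ (by positivity) hδ]
    calc T * δ ≤ n ^ 2 * δ := by gcongr
      _ = n * (δ * n) := by ring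
  have hSn : S ≤ δ * n ^ 2 := by
    have hS2 : S ^ 2 ≤ 2 * n ^ 3 := by
      rw [hS, hn]; exact_mod_cast sq_sum_degree_triangleSquareFreePart_le (G := G)
    refine le_of_sq_le_sq ?_ (by positivity)
    rw [div_le_iff₀ (by positivity)] at hn2
    calc S ^ 2 ≤ 2 * n ^ 3 := hS2
      _ ≤ n * δ ^ 2 * n ^ 3 := by gcongr
      _ = (δ * n ^ 2) ^ 2 := by ring
  have hlin : n / δ + 2 * n ≤ 2 * δ * n ^ 2 := by
    rw [div_le_iff₀ (by positivity)] at hn3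
    calc n / δ + 2 * n = (1 / δ + 2) * n := by ring
      _ ≤ n * (2 * δ) * n := by gcongr
      _ = 2 * δ * n ^ 2 := by ring
  have hkS : k * S ≤ k * (δ * n ^ 2) := by gcongr
  have hkn : 1 * (δ * n ^ 2) ≤ k * (δ * n ^ 2) := by gcongr
  -- The errors are `kδn²` from `D`, `4δn²` from `U` and `kδn²` from `S`; `k ≥ 1` gives the 6.
  have hfin : k * A ≤ n ^ 2 + k * (6 * (δ * n ^ 2)) := by
    linarith
  rw [hA] at hfin
  have : n ^ 2 / (2 * (k : ℝ)) + 3 * δ * n ^ 2 =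
      (n ^ 2 + k * (6 * (δ * n ^ 2))) / (2 * k) := by
    field_simp
    ring
  rw [this, le_div_iff₀ (by positivity)]
  linarith

theorem card_edgeFinset_le_card_sq {V : Type*} [Fintype V] (G : SimpleGraph V)
    [Fintype G.edgeSet] : (#G.edgeFinset : ℝ) ≤ (Fintype.card V : ℝ) ^ 2 := by
  classical
  have h1 := G.sum_degrees_eq_twice_card_edges
  have h2 := G.sum_degree_le_card_sq
  have h3 : #G.edgeFinset ≤ Fintype.card V ^ 2 := by
    refine le_trans ?_ (h1.ge.trans h2 |>.trans' (Nat.le_mul_of_pos_left _ two_pos))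
    exact le_of_eq (by congr!)
  exact_mod_cast h3

end SimpleGraph

theorem mainTheorem1 :
    ∃ f : ℕ → ℝ,
      Asymptotics.IsLittleO Filter.atTop f (fun n : ℕ => (n : ℝ) ^ 2) ∧
      ∀ (k : ℕ), 3 ≤ k →
        ∀ (V : Type*) [Fintype V] (G : SimpleGraph V) [Fintype G.edgeSet],
          G.IsDiameterCritical k →
            (G.edgeFinset.card : ℝ) ≤
              (Fintype.card V : ℝ) ^ 2 / (2 * (k : ℝ)) +
                (k : ℝ) ^ 2 * f (Fintype.card V) := by
  -- The least admissible `ε` for each `n` turns the `ε`–`N` bound into one function; the factor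
  -- `k²` is pure slack.
  let B : ℕ → Set ℝ := fun n ↦ {ε | 0 ≤ ε ∧ ∀ (k : ℕ), 3 ≤ k →
    ∀ (V : Type _) [Fintype V] (G : SimpleGraph V) [Fintype G.edgeSet], Fintype.card V = n →
      G.IsDiameterCritical k →
        (#G.edgeFinset : ℝ) ≤ (n : ℝ) ^ 2 / (2 * (k : ℝ)) + ε * (n : ℝ) ^ 2}
  have hbdd : ∀ n, BddBelow (B n) := fun n ↦ ⟨0, fun ε h ↦ h.1⟩
  have hne : ∀ n, (B n).Nonempty := fun n ↦ ⟨1, zero_le_one, fun k _ V _ G _ hV _ ↦ by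
    have h1 := G.card_edgeFinset_le_card_sq
    rw [hV] at h1
    have : 0 ≤ (n : ℝ) ^ 2 / (2 * (k : ℝ)) := by positivity
    linarith⟩
  have h0 : ∀ n, 0 ≤ sInf (B n) := fun n ↦ le_csInf (hne n) fun ε h ↦ h.1
  refine ⟨fun n ↦ sInf (B n) * (n : ℝ) ^ 2, ?_, fun k hk V _ G _ h ↦ ?_⟩
  · rw [Asymptotics.isLittleO_iff]
    intro c hc
    obtain ⟨N, hN⟩ := SimpleGraph.exists_forall_card_edgeFinset_le hc
    filter_upwards [Filter.eventually_ge_atTop N] with n hn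
    rw [norm_mul, Real.norm_of_nonneg (h0 n)]
    gcongr
    refine csInf_le (hbdd n) ⟨hc.le, fun k hk V _ G _ hV h ↦ ?_⟩
    subst hV
    exact hN k (by omega) V G hn h
  · have h1 := G.card_edgeFinset_le_card_sq
    set n := Fintype.card V with hn
    have hf : 0 ≤ sInf (B n) * (n : ℝ) ^ 2 := mul_nonneg (h0 n) (by positivity)
    have hk1 : (1 : ℝ) ≤ (k : ℝ) ^ 2 := one_le_pow₀ (by exact_mod_cast (by omega : 1 ≤ k))
    have hkf : 1 * (sInf (B n) * (n : ℝ) ^ 2) ≤ (k : ℝ) ^ 2 * (sInf (B n) * (n : ℝ) ^ 2) := by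
      gcongr
    suffices (#G.edgeFinset : ℝ) - (n : ℝ) ^ 2 / (2 * (k : ℝ)) ≤ sInf (B n) * (n : ℝ) ^ 2 by
      linarith
    -- The case `n = 0` is separate because the bound is divided by `n²`.
    rcases (Nat.zero_le n).eq_or_lt with hn0 | hn0
    · rw [← hn0] at h1 ⊢
      simpa using h1
    · have hn2 : (0 : ℝ) < (n : ℝ) ^ 2 := by positivity
      rw [← div_le_iff₀ hn2]
      refine le_csInf (hne n) fun ε hε ↦ ?_
      rw [div_le_iff₀ hn2]
      have := hε.2 k hk V G hn.symm h
      linarith
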